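/- Let $\sigma>0$, $A>0$, and let $h$ be a real random variable with $\mathbb{E}h^4<\infty$ and $\mathbb{E}h\neq 0$. Consider the fast fading channel $\mathcal{G}_{fast}$, $y_t=h_tx_t+z_t$ ($1\le t\le n$), where the $h_t$ are i.i.d. copies of $h$, the $z_t$ are i.i.d. $N(0,\sigma^2)$, and $(h_t)$ and $(z_t)$ are independent. An $(M,n,\lambda_1,\lambda_2)$ deterministic identification (DI) code for $\mathcal{G}_{fast}$ without side information, under the input constraint $A$, consists of codewords $\mathbf{u}_1,\dots,\mathbf{u}_M\in\mathbb{R}^n$ with $\|\mathbf{u}_i\|_2^2\le nA$ and measurable, possibly overlapping decoding regions $D_1,\dots,D_M\subset\mathbb{R}^n$ (which do not depend on the fading coefficients) such that, for all $i\neq j$ in $\{1,\dots,M\}$ (for all $i$ in the first line), \[ \int_{\mathbb{R}^n}\int_{D_i^c} f_{\mathbf z}(\mathbf{y}-\mathrm{diag}(\mathbf{h})\mathbf{u}_i)\,d\mathbf{y}\,dP_{\mathbf h}\le\lambda_1, \] \[ \int_{\mathbb{R}^n}\int_{D_j} f_{\mathbf z}(\mathbf{y}-\mathrm{diag}(\mathbf{h})\mathbf{u}_i)\,d\mathbf{y}\,dP_{\mathbf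 h}\le\lambda_2, \] where $f_{\mathbf z}(\mathbf z)=(2\pi\sigma^2)^{-n/2}e^{-\|\mathbf z\|_2^2/(2\sigma^2)}$ and $P_{\mathbf h}$ is the law of $\mathbf{h}=(h_1,\dots,h_n)$. A rate $R>0$ is achievable if for all $\lambda_1,\lambda_2>0$ there is $n_0$ such that for every $n\ge n_0$ there exists a $(\lceil n^{nR}\rceil,n,\lambda_1,\lambda_2)$ DI code. Let $C_{DI}(\mathcal{G}_{fast})\in[0,\infty]$ be the supremum of the achievable rates. Then \[ C_{DI}(\mathcal{G}_{fast})\ge \tfrac14 . \] -/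

import Mathlib

open MeasureTheory
open scoped ENNReal

noncomputable section

namespace FastFading

/-- The density of the noise vector `(z₁, …, zₙ)` with i.i.d. entries `N(0, σ²)`:
`f(z) = (2πσ²)^(-n/2) · exp(-‖z‖₂² / (2σ²))`. -/
def noiseDensity (σ : ℝ) {n : ℕ} (z : Fin n → ℝ) : ℝ :=
  1 / (2 * Real.pi * σ ^ 2) ^ ((n : ℝ) / 2) * Real.exp (-(∑ t, z t ^ 2) / (2 * σ ^ 2))

/-- The probability that the output `y_t = h_t x_t + z_t` lies in `D` when `x` is sent and the
fading coefficients `h_t` are i.i.d. with law `μ`: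
`∫ ∫_D f(y - diag(h) x) dy dP_𝐡`, where `P_𝐡` is the `n`-fold product of `μ`. -/
def outputProb (μ : Measure ℝ) (σ : ℝ) {n : ℕ} (x : Fin n → ℝ) (D : Set (Fin n → ℝ)) : ℝ≥0∞ :=
  ∫⁻ h : Fin n → ℝ, (∫⁻ y in D, ENNReal.ofReal (noiseDensity σ (fun t => y t - h t * x t)))
    ∂(Measure.pi fun _ : Fin n => μ)

/-- An `(M, n)` deterministic identification (DI) code without side information under the input
constraint `A`: `M` codewords in `ℝⁿ` with `‖u_i‖₂² ≤ n A`, and `M` (measurable, possibly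
overlapping) decoding regions, which do not depend on the fading coefficients. -/
structure DICode (A : ℝ) (M n : ℕ) where
  codeword : Fin M → Fin n → ℝ
  region : Fin M → Set (Fin n → ℝ)
  power_le : ∀ i, ∑ t, codeword i t ^ 2 ≤ n * A
  measurableSet_region : ∀ i, MeasurableSet (region i)

variable {A : ℝ} {M n : ℕ}

/-- Error of the first type: identity `i` is sent and receiver `i` rejects. -/
def DICode.errorOne (c : DICode A M n) (μ : Measure ℝ) (σ : ℝ) (i : Fin M) : ℝ≥0∞ :=
  outputProb μ σ (c.codeword i) (c.region i)ᶜ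

/-- Error of the second type: identity `i` is sent and receiver `j` accepts. -/
def DICode.errorTwo (c : DICode A M n) (μ : Measure ℝ) (σ : ℝ) (i j : Fin M) : ℝ≥0∞ :=
  outputProb μ σ (c.codeword i) (c.region j)

/-- `c` is an `(M, n, l₁, l₂)` DI code for the fast fading channel. -/
def DICode.HasErrorsLE (c : DICode A M n) (μ : Measure ℝ) (σ l₁ l₂ : ℝ) : Prop :=
  (∀ i, c.errorOne μ σ i ≤ ENNReal.ofReal l₁) ∧
    ∀ i j, i ≠ j → c.errorTwo μ σ i j ≤ ENNReal.ofReal l₂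

/-- `R > 0` is achievable if for all `l₁, l₂ > 0` and all sufficiently large `n` there is an
`(n^(nR), n, l₁, l₂)` DI code, where `n^(nR)` is rounded up if it is not an integer. -/
def IsAchievable (μ : Measure ℝ) (σ A R : ℝ) : Prop :=
  0 < R ∧ ∀ l₁ l₂ : ℝ, 0 < l₁ → 0 < l₂ → ∃ n₀ : ℕ, ∀ n : ℕ, n₀ ≤ n →
    ∃ c : DICode A ⌈(n : ℝ) ^ ((n : ℝ) * R)⌉₊ n, c.HasErrorsLE μ σ l₁ l₂

/-- The DI capacity of the fast fading channel without side information: the supremum, in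
`[0, ∞]`, of the achievable rates. -/
def capacityDI (μ : Measure ℝ) (σ A : ℝ) : ℝ≥0∞ :=
  ⨆ (R : ℝ) (_ : IsAchievable μ σ A R), ENNReal.ofReal R

end FastFading

end

open ProbabilityTheory Filter Topology
open scoped Finset Matrix NNReal SetRel

/-!
Codewords are points of the grid `(√A / K) · {0, …, K - 1}ⁿ` with `K ≈ n ^ γ`, `γ < 1/4`. By
pigeonhole and the Gilbert–Varshamov argument, about `n ^ (n γ (1 - ε))` of them have equal norm
and pairwise Hamming distance above `ε n`. Receiver `j` accepts `y` when the correlation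
`⟨u_j, y⟩` is within `τ` of `E[h] ‖u_j‖²`. If `u_i` is sent, the mean of this correlation is
`E[h] ⟨u_j, u_i⟩` and, the norms being equal, `‖u_j‖² - ⟨u_j, u_i⟩ = ‖u_i - u_j‖² / 2 ≳
n ^ (1 - 2 γ)`, while its standard deviation is only `O(√n)`. Chebyshev's inequality therefore
separates the hypotheses as soon as `1 - 2 γ > 1/2`.
-/

section Combinatorics

variable {α ι : Type*}

lemma exists_isSeparated_card_le_mul (U : SetRel α α) [U.IsRefl] [U.IsSymm]
    [DecidableRel (· ~[U] ·)] (W : Finset α) {N : ℕ} (hN : ∀ x ∈ W, #{y ∈ W | y ~[U] x} ≤ N) :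
    ∃ S ⊆ W, U.IsSeparated (S : Set α) ∧ #W ≤ #S * N := by
  classical
  have hfin : {T : Set α | T ⊆ W ∧ U.IsSeparated T}.Finite :=
    W.finite_toSet.finite_subsets.subset fun T hT => hT.1
  obtain ⟨T, hT⟩ := hfin.exists_maximal ⟨∅, Set.empty_subset _, .empty⟩
  lift T to Finset α using W.finite_toSet.subset hT.1.1
  have hTW : T ⊆ W := Finset.coe_subset.1 hT.1.1
  have hcover : W ⊆ T.biUnion fun x => {y ∈ W | y ~[U] x} := fun y hy => by
    obtain ⟨x, hx, hyx⟩ := SetRel.IsCover.of_maximal_isSeparated hT (Finset.mem_coe.2 hy)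
    exact Finset.mem_biUnion.2 ⟨x, hx, Finset.mem_filter.2 ⟨hy, hyx⟩⟩
  exact ⟨T, hTW, hT.1.2, (Finset.card_le_card hcover).trans
    (Finset.card_biUnion_le_card_mul _ _ _ fun x hx => hN x (hTW hx))⟩

lemma card_hammingBall_le [Fintype ι] [DecidableEq ι] [Fintype α] [DecidableEq α] [Nonempty α]
    (x : ι → α) (m : ℕ) :
    #{y : ι → α | hammingDist y x ≤ m} ≤ 2 ^ Fintype.card ι * Fintype.card α ^ m := by
  let agreeOff (T : Finset ι) : Finset (ι → α) :=
    Fintype.piFinset fun t => if t ∈ T then Finset.univ else {x t}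
  have hcard (T : Finset ι) : #(agreeOff T) = Fintype.card α ^ #T := by
    simp [agreeOff, Fintype.card_piFinset, apply_ite Finset.card]
  have hcover : ({y | hammingDist y x ≤ m} : Finset (ι → α)) ⊆
      ({T | #T ≤ m} : Finset (Finset ι)).biUnion agreeOff := by
    intro y hy
    refine Finset.mem_biUnion.2 ⟨({t | y t ≠ x t} : Finset ι), by simpa [hammingDist] using hy, ?_⟩
    refine Fintype.mem_piFinset.2 fun t => ?_
    by_cases h : y t = x t <;> simp [h]
  calc #{y : ι → α | hammingDist y x ≤ m}
      ≤ #{T : Finset ι | #T ≤ m} * Fintype.card α ^ m :=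
        (Finset.card_le_card hcover).trans <| Finset.card_biUnion_le_card_mul _ _ _ fun T hT =>
          (hcard T).trans_le (Nat.pow_le_pow_right Fintype.card_pos (Finset.mem_filter.1 hT).2)
    _ ≤ 2 ^ Fintype.card ι * Fintype.card α ^ m := by
        gcongr
        exact (Finset.card_le_univ _).trans_eq Fintype.card_finset

lemma exists_hammingDist_gt_card_le_mul [Fintype ι] [Fintype α] [DecidableEq α] [Nonempty α]
    (W : Finset (ι → α)) (m : ℕ) :
    ∃ S ⊆ W, (S : Set (ι → α)).Pairwise (fun x y => m < hammingDist x y) ∧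
      #W ≤ #S * (2 ^ Fintype.card ι * Fintype.card α ^ m) := by
  classical
  let U : SetRel (ι → α) (ι → α) := {p | hammingDist p.1 p.2 ≤ m}
  have : U.IsRefl := ⟨fun x => by simp [U]⟩
  have : U.IsSymm := ⟨fun x y h => by simpa [U, hammingDist_comm] using h⟩
  obtain ⟨S, hSW, hS, hcard⟩ := exists_isSeparated_card_le_mul U W fun x _ =>
    (Finset.card_le_card fun y hy => by simpa [U] using (Finset.mem_filter.1 hy).2).trans
      (card_hammingBall_le x m)
  exact ⟨S, hSW, fun x hx y hy hxy => not_le.1 (hS hx hy hxy), hcard⟩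

lemma exists_equalEnergy_code {n K m M : ℕ} (hK : 0 < K)
    (hM : (n * K ^ 2 + 1) * (M * (2 ^ n * K ^ m)) ≤ K ^ n) :
    ∃ w : Fin M → Fin n → Fin K,
      (∀ i j, ∑ t, (w i t : ℕ) ^ 2 = ∑ t, (w j t : ℕ) ^ 2) ∧
        Pairwise fun i j => m < hammingDist (w i) (w j) := by
  have : NeZero K := ⟨hK.ne'⟩
  let energy (w : Fin n → Fin K) : ℕ := ∑ t, (w t : ℕ) ^ 2
  have henergy (w : Fin n → Fin K) : energy w ≤ n * K ^ 2 := by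
    simpa using Finset.sum_le_card_nsmul Finset.univ (fun t => (w t : ℕ) ^ 2) (K ^ 2)
      fun t _ => Nat.pow_le_pow_left (w t).2.le 2
  obtain ⟨s, -, hs⟩ : ∃ s ∈ Finset.range (n * K ^ 2 + 1),
      M * (2 ^ n * K ^ m) ≤ #{w : Fin n → Fin K | energy w = s} :=
    Finset.exists_le_card_fiber_of_mul_le_card_of_maps_to
      (fun w _ => Finset.mem_range.2 (Nat.lt_succ_of_le (henergy w))) (by simp) (by simpa using hM)
  obtain ⟨S, hSW, hS, hcard⟩ :=
    exists_hammingDist_gt_card_le_mul ({w | energy w = s} : Finset (Fin n → Fin K)) m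
  have hMS : M ≤ #S := by
    simp only [Fintype.card_fin] at hcard
    exact Nat.le_of_mul_le_mul_right (hs.trans hcard) (by positivity)
  obtain ⟨e⟩ : Nonempty (Fin M ↪ S) := Function.Embedding.nonempty_of_card_le (by simpa using hMS)
  have he (i : Fin M) : energy (e i) = s := (Finset.mem_filter.1 (hSW (e i).2)).2
  exact ⟨fun i => e i, fun i j => (he i).trans (he j).symm, fun i j hij =>
    hS (e i).2 (e j).2 fun h => hij (e.injective (Subtype.ext h))⟩

end Combinatorics

section Measure

variable {ι : Type*} [Fintype ι]

lemma pi_withDensity_ofReal {α : ι → Type*} [∀ i, MeasurableSpace (α i)]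
    (μ : ∀ i, Measure (α i)) [∀ i, SigmaFinite (μ i)] {f : ∀ i, α i → ℝ}
    (hf : ∀ i, Integrable (f i) (μ i)) (hf₀ : ∀ i, 0 ≤ f i) :
    Measure.pi (fun i => (μ i).withDensity fun x => ENNReal.ofReal (f i x)) =
      (Measure.pi μ).withDensity fun x => ENNReal.ofReal (∏ i, f i (x i)) := by
  have := fun i => isFiniteMeasure_withDensity_ofReal (hf i).hasFiniteIntegral
  refine Measure.pi_eq fun s hs => ?_
  rw [withDensity_apply _ (.univ_pi hs), Measure.restrict_pi_pi,
    ← ofReal_integral_eq_lintegral_ofReal (.fintype_prod_dep fun i => (hf i).restrict)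
      (ae_of_all _ fun x => Finset.prod_nonneg fun i _ => hf₀ i (x i)),
    integral_fintype_prod_eq_prod,
    ENNReal.ofReal_prod_of_nonneg fun i _ => integral_nonneg (hf₀ i)]
  refine Finset.prod_congr rfl fun i _ => ?_
  rw [withDensity_apply _ (hs i),
    ofReal_integral_eq_lintegral_ofReal (hf i).restrict (ae_of_all _ (hf₀ i))]

variable (ν : ι → Measure ℝ) [∀ i, IsProbabilityMeasure (ν i)]

lemma memLp_dotProduct_pi {p : ℝ≥0∞} (hν : ∀ i, MemLp id p (ν i)) (c : ι → ℝ) :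
    MemLp (fun w => c ⬝ᵥ w) p (Measure.pi ν) :=
  memLp_finsetSum _ fun i _ =>
    ((hν i).comp_measurePreserving (measurePreserving_eval ν i)).const_mul (c i)

lemma integral_dotProduct_pi (hν : ∀ i, Integrable id (ν i)) (c : ι → ℝ) :
    ∫ w, c ⬝ᵥ w ∂Measure.pi ν = c ⬝ᵥ fun i => ∫ x, x ∂ν i := by
  have hint (i : ι) : Integrable (fun w : ι → ℝ => c i * w i) (Measure.pi ν) :=
    (integrable_comp_eval (f := id) (hν i)).const_mul (c i)
  simp only [dotProduct]
  rw [integral_finsetSum _ fun i _ => hint i]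
  refine Finset.sum_congr rfl fun i _ => ?_
  rw [integral_const_mul]
  exact congrArg _ (integral_comp_eval (μ := ν) (f := id) (hν i).aestronglyMeasurable)

lemma variance_dotProduct_pi (hν : ∀ i, MemLp id 2 (ν i)) (c : ι → ℝ) :
    Var[fun w => c ⬝ᵥ w; Measure.pi ν] = ∑ i, c i ^ 2 * Var[id; ν i] := by
  have h := variance_sum_pi (μ := ν) (X := fun i x => c i * x) fun i => (hν i).const_mul (c i)
  simp only [Finset.sum_fn] at h
  exact h.trans (Finset.sum_congr rfl fun i _ => variance_const_mul (c i) id (ν i))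

end Measure

lemma memLp_of_integrable_pow {Ω 𝕜 : Type*} [MeasurableSpace Ω] [NormedDivisionRing 𝕜]
    {μ : Measure Ω} {f : Ω → 𝕜} (hf : AEStronglyMeasurable f μ) {p : ℕ} (hp : p ≠ 0)
    (hint : Integrable (fun x => f x ^ p) μ) : MemLp f p μ := by
  rw [← integrable_norm_rpow_iff hf (by exact_mod_cast hp) (ENNReal.natCast_ne_top p)]
  simpa using hint.norm

namespace FastFading

lemma outputProb_mono (μ : Measure ℝ) (σ : ℝ) {n : ℕ} (x : Fin n → ℝ) {D E : Set (Fin n → ℝ)}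
    (h : D ⊆ E) : outputProb μ σ x D ≤ outputProb μ σ x E :=
  lintegral_mono fun _ => lintegral_mono_set h

lemma DICode.HasErrorsLE.mono {A : ℝ} {M n : ℕ} {c : DICode A M n} {μ : Measure ℝ}
    {σ l₁ l₂ l₁' l₂' : ℝ} (h : c.HasErrorsLE μ σ l₁ l₂) (h₁ : l₁ ≤ l₁') (h₂ : l₂ ≤ l₂') :
    c.HasErrorsLE μ σ l₁' l₂' :=
  ⟨fun i => (h.1 i).trans (ENNReal.ofReal_le_ofReal h₁),
    fun i j hij => (h.2 i j hij).trans (ENNReal.ofReal_le_ofReal h₂)⟩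

section Correlation

/-- The law `N(0, σ²)` of the noise in a single channel use. -/
noncomputable abbrev noiseLaw (σ : ℝ) : Measure ℝ := gaussianReal 0 (σ ^ 2).toNNReal

lemma noiseDensity_eq_prod_gaussianPDFReal (σ : ℝ) {n : ℕ} (z : Fin n → ℝ) :
    noiseDensity σ z = ∏ t, gaussianPDFReal 0 (σ ^ 2).toNNReal (z t) := by
  have hvar : 0 ≤ 2 * Real.pi * σ ^ 2 := by positivity
  simp only [gaussianPDFReal, Real.coe_toNNReal _ (sq_nonneg σ), sub_zero, Finset.prod_mul_distrib,
    Finset.prod_const, Finset.card_univ, Fintype.card_fin, ← Real.exp_sum, noiseDensity]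
  congr 1
  · rw [inv_pow, one_div, Real.sqrt_eq_rpow, ← Real.rpow_mul_natCast hvar, one_div_mul_eq_div]
  · rw [← Finset.sum_div, Finset.sum_neg_distrib]

lemma pi_noiseLaw_eq_withDensity {σ : ℝ} (hσ : σ ≠ 0) (n : ℕ) :
    Measure.pi (fun _ : Fin n => noiseLaw σ) =
      volume.withDensity fun z => ENNReal.ofReal (noiseDensity σ z) := by
  have hvar : (σ ^ 2).toNNReal ≠ 0 := (Real.toNNReal_pos.2 (by positivity)).ne'
  simp only [noiseLaw, gaussianReal_of_var_ne_zero 0 hvar, noiseDensity_eq_prod_gaussianPDFReal]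
  exact pi_withDensity_ofReal _ (fun _ => integrable_gaussianPDFReal 0 _)
    fun _ => gaussianPDFReal_nonneg 0 _

lemma outputProb_eq_prod (μ : Measure ℝ) {σ : ℝ} (hσ : σ ≠ 0) {n : ℕ} (x : Fin n → ℝ)
    {D : Set (Fin n → ℝ)} (hD : MeasurableSet D) :
    outputProb μ σ x D =
      ((Measure.pi fun _ : Fin n => μ).prod (Measure.pi fun _ : Fin n => noiseLaw σ))
        {p | p.2 + p.1 * x ∈ D} := by
  have hevent : MeasurableSet {p : (Fin n → ℝ) × (Fin n → ℝ) | p.2 + p.1 * x ∈ D} :=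
    measurableSet_preimage (by fun_prop) hD
  have hdensity : Measurable (noiseDensity σ : (Fin n → ℝ) → ℝ) := by
    unfold noiseDensity
    fun_prop
  rw [Measure.prod_apply hevent, outputProb]
  refine lintegral_congr fun h => ?_
  rw [pi_noiseLaw_eq_withDensity hσ, withDensity_apply _ (measurable_prodMk_left hevent)]
  have hshift := (measurePreserving_add_right volume (h * x)).setLIntegral_comp_preimage hD
    (f := fun y => ENNReal.ofReal (noiseDensity σ fun t => y t - h t * x t)) (by fun_prop)
  simp only [Pi.add_apply, Pi.mul_apply, add_sub_cancel_right] at hshift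
  exact hshift.symm

variable {μ : Measure ℝ} [IsProbabilityMeasure μ] {σ : ℝ} {n : ℕ}

lemma outputProb_dotProduct_deviation_le (hμ : MemLp id 2 μ) (hσ : σ ≠ 0) (x u : Fin n → ℝ)
    {τ : ℝ} (hτ : 0 < τ) :
    outputProb μ σ x {y | τ ≤ |u ⬝ᵥ y - (∫ h, h ∂μ) * (u ⬝ᵥ x)|} ≤
      ENNReal.ofReal ((∑ t, ((u t * x t) ^ 2 * Var[id; μ] + u t ^ 2 * σ ^ 2)) / τ ^ 2) := by
  have hnoise : MemLp id 2 (noiseLaw σ) := memLp_id_gaussianReal' 2 (by simp)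
  let P := (Measure.pi fun _ : Fin n => μ).prod (Measure.pi fun _ : Fin n => noiseLaw σ)
  let X (h : Fin n → ℝ) : ℝ := (u * x) ⬝ᵥ h
  let Z (z : Fin n → ℝ) : ℝ := u ⬝ᵥ z
  have hX : MemLp X 2 (Measure.pi fun _ => μ) := memLp_dotProduct_pi _ (fun _ => hμ) _
  have hZ : MemLp Z 2 (Measure.pi fun _ => noiseLaw σ) :=
    memLp_dotProduct_pi _ (fun _ => hnoise) _
  have hcorr (h z : Fin n → ℝ) : u ⬝ᵥ (z + h * x) = X h + Z z := by
    simp only [X, Z, dotProduct, Pi.add_apply, Pi.mul_apply, ← Finset.sum_add_distrib]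
    exact Finset.sum_congr rfl fun t _ => by ring
  have hmean : ∫ p, X p.1 + Z p.2 ∂P = (∫ h, h ∂μ) * (u ⬝ᵥ x) := by
    rw [integral_add ((hX.comp_fst _).integrable one_le_two)
        ((hZ.comp_snd _).integrable one_le_two), integral_fun_fst, integral_fun_snd,
      integral_dotProduct_pi _ (fun _ => hμ.integrable one_le_two),
      integral_dotProduct_pi _ (fun _ => hnoise.integrable one_le_two)]
    simp [dotProduct, Finset.mul_sum, mul_comm]
  have hvar : Var[fun p => X p.1 + Z p.2; P] =
      ∑ t, ((u t * x t) ^ 2 * Var[id; μ] + u t ^ 2 * σ ^ 2) := by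
    rw [variance_add_prod hX hZ, variance_dotProduct_pi _ (fun _ => hμ),
      variance_dotProduct_pi _ (fun _ => hnoise), ← Finset.sum_add_distrib]
    simp [sq_nonneg]
  have hcheb : P {p | τ ≤ |X p.1 + Z p.2 - ∫ q, X q.1 + Z q.2 ∂P|} ≤
      ENNReal.ofReal (Var[fun p => X p.1 + Z p.2; P] / τ ^ 2) :=
    meas_ge_le_variance_div_sq ((hX.comp_fst _).add (hZ.comp_snd _)) hτ
  rw [hmean, hvar] at hcheb
  rw [outputProb_eq_prod μ hσ x
    (measurableSet_le measurable_const (by unfold dotProduct; fun_prop))]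
  simpa only [Set.mem_ofPred_eq, hcorr] using hcheb

/-- An upper bound for the contribution of one channel use to the variance of the correlation
`⟨u, y⟩`, when the entries of `u` and of the transmitted word have square at most `A`. -/
noncomputable def symbolVariance (μ : Measure ℝ) (σ A : ℝ) : ℝ := A ^ 2 * Var[id; μ] + A * σ ^ 2

lemma outputProb_dotProduct_deviation_le_of_sq_le (hμ : MemLp id 2 μ) (hσ : σ ≠ 0)
    {x u : Fin n → ℝ} {A τ : ℝ} (hx : ∀ t, x t ^ 2 ≤ A) (hu : ∀ t, u t ^ 2 ≤ A) (hτ : 0 < τ) :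
    outputProb μ σ x {y | τ ≤ |u ⬝ᵥ y - (∫ h, h ∂μ) * (u ⬝ᵥ x)|} ≤
      ENNReal.ofReal (n * symbolVariance μ σ A / τ ^ 2) := by
  refine (outputProb_dotProduct_deviation_le hμ hσ x u hτ).trans (ENNReal.ofReal_le_ofReal ?_)
  have hsymbol (t : Fin n) :
      (u t * x t) ^ 2 * Var[id; μ] + u t ^ 2 * σ ^ 2 ≤ symbolVariance μ σ A := by
    have hA : 0 ≤ A := (sq_nonneg _).trans (hu t)
    have hvar : 0 ≤ Var[id; μ] := variance_nonneg id μ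
    rw [symbolVariance, mul_pow, sq A]
    gcongr
    exacts [hu t, hx t, hu t]
  gcongr
  simpa using Finset.sum_le_card_nsmul Finset.univ _ _ fun t _ => hsymbol t

variable {A : ℝ} {M : ℕ}

/-- The DI code with codewords `u` whose receiver `j` accepts `y` when the correlation `⟨u_j, y⟩`
is within `τ` of `a ‖u_j‖²`, where `a` stands for the mean fading coefficient. -/
def correlationCode (u : Fin M → Fin n → ℝ) (hu : ∀ i, ∑ t, u i t ^ 2 ≤ n * A) (a τ : ℝ) :
    DICode A M n where
  codeword := u
  region j := {y | |u j ⬝ᵥ y - a * (u j ⬝ᵥ u j)| < τ}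
  power_le := hu
  measurableSet_region j :=
    measurableSet_lt (by unfold dotProduct; fun_prop) measurable_const

lemma correlationCode_hasErrorsLE (hμ : MemLp id 2 μ) (hσ : σ ≠ 0) {u : Fin M → Fin n → ℝ}
    (hu : ∀ i, ∑ t, u i t ^ 2 ≤ n * A) {τ : ℝ} (hτ : 0 < τ) (hpeak : ∀ i t, u i t ^ 2 ≤ A)
    (hgap : ∀ i j, i ≠ j → 2 * τ ≤ |∫ h, h ∂μ| * (u j ⬝ᵥ u j - u j ⬝ᵥ u i)) :
    (correlationCode u hu (∫ h, h ∂μ) τ).HasErrorsLE μ σ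
      (n * symbolVariance μ σ A / τ ^ 2) (n * symbolVariance μ σ A / τ ^ 2) := by
  set a := ∫ h, h ∂μ
  have hdeviation (i j : Fin M) :
      outputProb μ σ (u i) {y | τ ≤ |u j ⬝ᵥ y - a * (u j ⬝ᵥ u i)|} ≤
        ENNReal.ofReal (n * symbolVariance μ σ A / τ ^ 2) :=
    outputProb_dotProduct_deviation_le_of_sq_le hμ hσ (hpeak i) (hpeak j) hτ
  refine ⟨fun i => (outputProb_mono μ σ _ fun y hy => ?_).trans (hdeviation i i),
    fun i j hij => (outputProb_mono μ σ _ fun y hy => ?_).trans (hdeviation i j)⟩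
  · have hreject : ¬|u i ⬝ᵥ y - a * (u i ⬝ᵥ u i)| < τ := hy
    exact not_lt.1 hreject
  · have haccept : |u j ⬝ᵥ y - a * (u j ⬝ᵥ u j)| < τ := hy
    have hseparation : 2 * τ ≤ |a * (u j ⬝ᵥ u j) - a * (u j ⬝ᵥ u i)| := by
      rw [← mul_sub, abs_mul]
      exact (hgap i j hij).trans (by gcongr; exact le_abs_self _)
    have htriangle := abs_sub_le (a * (u j ⬝ᵥ u j)) (u j ⬝ᵥ y) (a * (u j ⬝ᵥ u i))
    rw [abs_sub_comm (a * (u j ⬝ᵥ u j)) (u j ⬝ᵥ y)] at htriangle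
    change τ ≤ |u j ⬝ᵥ y - a * (u j ⬝ᵥ u i)|
    linarith

end Correlation

section Grid

lemma two_mul_dotProduct_self_sub {ι R : Type*} [Fintype ι] [CommRing R] {u v : ι → R}
    (h : u ⬝ᵥ u = v ⬝ᵥ v) : 2 * (v ⬝ᵥ v - v ⬝ᵥ u) = (v - u) ⬝ᵥ (v - u) := by
  rw [sub_dotProduct, dotProduct_sub, dotProduct_sub, dotProduct_comm u v, h]
  ring

lemma hammingDist_le_sum_sq_sub {ι : Type*} [Fintype ι] {K : ℕ} (v w : ι → Fin K) :
    (hammingDist v w : ℝ) ≤ ∑ t, ((v t : ℝ) - (w t : ℝ)) ^ 2 := by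
  have hsymbol (t : ι) : (if v t ≠ w t then 1 else 0 : ℝ) ≤ ((v t : ℝ) - (w t : ℝ)) ^ 2 := by
    split_ifs with h
    · exact (one_le_sq_iff_one_le_abs _).2 (Nat.pairwise_one_le_dist (Fin.val_ne_of_ne h))
    · positivity
  calc (hammingDist v w : ℝ) = ∑ t, if v t ≠ w t then 1 else 0 := by
        rw [hammingDist, Finset.card_filter, Nat.cast_sum]
        simp
    _ ≤ ∑ t, ((v t : ℝ) - (w t : ℝ)) ^ 2 := Finset.sum_le_sum fun t _ => hsymbol t

variable {A : ℝ} {ι : Type*} {K : ℕ}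

/-- The point of the grid `(√A / K) · {0, …, K - 1}ⁿ`, contained in the cube `[0, √A]ⁿ`, with
integer coordinates `w`. -/
noncomputable def gridPoint (A : ℝ) (w : ι → Fin K) : ι → ℝ := fun t => √A / K * (w t : ℝ)

lemma sq_gridPoint_le (hA : 0 ≤ A) (w : ι → Fin K) (t : ι) : gridPoint A w t ^ 2 ≤ A := by
  have hK : (0 : ℝ) < K := by exact_mod_cast (w t).pos
  have hw : (w t : ℝ) ≤ K := by exact_mod_cast (w t).2.le
  calc gridPoint A w t ^ 2 ≤ (√A / K * K) ^ 2 := by unfold gridPoint; gcongr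
    _ = A := by rw [div_mul_cancel₀ _ hK.ne', Real.sq_sqrt hA]

variable [Fintype ι]

lemma gridPoint_dotProduct_self (hA : 0 ≤ A) (w : ι → Fin K) :
    gridPoint A w ⬝ᵥ gridPoint A w = A / K ^ 2 * (∑ t, (w t : ℕ) ^ 2 : ℕ) := by
  simp only [dotProduct, gridPoint, Nat.cast_sum, Nat.cast_pow, Finset.mul_sum, ← sq, mul_pow,
    div_pow, Real.sq_sqrt hA]

lemma mul_hammingDist_le_gridPoint_sub (hA : 0 ≤ A) (v w : ι → Fin K) :
    A / K ^ 2 * hammingDist v w ≤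
      (gridPoint A v - gridPoint A w) ⬝ᵥ (gridPoint A v - gridPoint A w) :=
  calc A / K ^ 2 * hammingDist v w ≤ A / K ^ 2 * ∑ t, ((v t : ℝ) - (w t : ℝ)) ^ 2 := by
        gcongr
        exact hammingDist_le_sum_sq_sub v w
    _ = (gridPoint A v - gridPoint A w) ⬝ᵥ (gridPoint A v - gridPoint A w) := by
        simp only [dotProduct, gridPoint, Pi.sub_apply, Finset.mul_sum, ← mul_sub, ← sq, mul_pow,
          div_pow, Real.sq_sqrt hA]

end Grid

section Rate

lemma codeSize_mul_le_pow {n K m M : ℕ} {R γ ε : ℝ} (hn : 1 ≤ n) (hγ : 0 ≤ γ)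
    (hγK : (n : ℝ) ^ γ ≤ K) (hKn : K ≤ n) (hmn : m ≤ n) (hmε : (m : ℝ) ≤ ε * n)
    (hM : (M : ℝ) ≤ 2 * (n : ℝ) ^ (n * R)) (hlarge : 64 ≤ (n : ℝ) ^ (γ * (1 - ε) - R)) :
    (n * K ^ 2 + 1) * (M * (2 ^ n * K ^ m)) ≤ K ^ n := by
  have hn1 : (1 : ℝ) ≤ n := by exact_mod_cast hn
  have hn0 : (0 : ℝ) < n := by linarith
  have hn2 : (n : ℝ) ≤ 2 ^ n := by exact_mod_cast Nat.lt_two_pow_self.le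
  have hKn' : (K : ℝ) ≤ n := by exact_mod_cast hKn
  have hpoly : (n : ℝ) * K ^ 2 + 1 ≤ 2 * 8 ^ n :=
    calc (n : ℝ) * K ^ 2 + 1 ≤ 2 ^ n * (2 ^ n) ^ 2 + 8 ^ n := by
          gcongr
          exacts [hKn'.trans hn2, one_le_pow₀ (by norm_num)]
      _ = 2 * 8 ^ n := by
          rw [← pow_succ', pow_right_comm, two_mul]; norm_num
  have hfour : (4 : ℝ) ≤ 4 ^ n := le_self_pow₀ (by norm_num) (by lia)
  have hexponent : γ * (1 - ε) * n ≤ γ * (n - m : ℕ) := by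
    rw [Nat.cast_sub hmn, mul_assoc]
    gcongr
    linarith
  -- `64 ^ n` absorbs the number of energy levels, the rounding of `M`, and the factor `2 ^ n`.
  have hreal : ((n : ℝ) * K ^ 2 + 1) * (M * (2 ^ n * (K : ℝ) ^ m)) ≤ (K : ℝ) ^ n :=
    calc ((n : ℝ) * K ^ 2 + 1) * (M * (2 ^ n * (K : ℝ) ^ m))
        ≤ 2 * 8 ^ n * (2 * (n : ℝ) ^ (n * R) * (2 ^ n * (K : ℝ) ^ m)) := by gcongr
      _ = 4 * 16 ^ n * (n : ℝ) ^ (n * R) * (K : ℝ) ^ m := by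
          rw [show (16 : ℝ) = 8 * 2 by norm_num, mul_pow]; ring
      _ ≤ 4 ^ n * 16 ^ n * (n : ℝ) ^ (n * R) * (K : ℝ) ^ m := by gcongr
      _ = 64 ^ n * (n : ℝ) ^ (n * R) * (K : ℝ) ^ m := by rw [← mul_pow]; norm_num
      _ ≤ ((n : ℝ) ^ (γ * (1 - ε) - R)) ^ n * (n : ℝ) ^ (n * R) * (K : ℝ) ^ m := by gcongr
      _ = (n : ℝ) ^ (γ * (1 - ε) * n) * (K : ℝ) ^ m := by
          rw [← Real.rpow_mul_natCast hn0.le, ← Real.rpow_add hn0]; ring_nf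
      _ ≤ (n : ℝ) ^ (γ * (n - m : ℕ)) * (K : ℝ) ^ m := by gcongr
      _ = ((n : ℝ) ^ γ) ^ (n - m) * (K : ℝ) ^ m := by rw [Real.rpow_mul_natCast hn0.le]
      _ ≤ (K : ℝ) ^ (n - m) * (K : ℝ) ^ m := by gcongr
      _ = (K : ℝ) ^ n := by rw [← pow_add, Nat.sub_add_cancel hmn]
  exact_mod_cast hreal

lemma rpow_mul_ceil_rpow_sq_le {x γ : ℝ} (hx : 1 ≤ x) (hγ : 0 ≤ γ) :
    x ^ (1 - 2 * γ) * (⌈x ^ γ⌉₊ : ℝ) ^ 2 ≤ 4 * x := by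
  have hx0 : 0 < x := by linarith
  have hceil : (⌈x ^ γ⌉₊ : ℝ) ≤ 2 * x ^ γ :=
    Nat.ceil_le_two_mul (by linarith [Real.one_le_rpow hx hγ])
  have hsq : x ^ (1 - 2 * γ) * (x ^ γ) ^ 2 = x := by
    rw [← Real.rpow_mul_natCast hx0.le, ← Real.rpow_add hx0, Nat.cast_ofNat, mul_comm γ,
      sub_add_cancel, Real.rpow_one]
  calc x ^ (1 - 2 * γ) * (⌈x ^ γ⌉₊ : ℝ) ^ 2 ≤ x ^ (1 - 2 * γ) * (2 * x ^ γ) ^ 2 := by gcongr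
    _ = 4 * x := by linear_combination 4 * hsq

lemma div_rpow_sq_eq_rpow {x : ℝ} (hx : 0 < x) (γ : ℝ) :
    x / (x ^ (1 - 2 * γ)) ^ 2 = x ^ (4 * γ - 1) := by
  rw [div_eq_iff (by positivity), ← Real.rpow_mul_natCast hx.le, ← Real.rpow_add hx]
  convert (Real.rpow_one x).symm using 2
  push_cast
  ring

variable {μ : Measure ℝ} [IsProbabilityMeasure μ] {σ A : ℝ}

lemma exists_DICode_hasErrorsLE (hμ : MemLp id 2 μ) (hσ : σ ≠ 0) (hA : 0 ≤ A) {n K m M : ℕ}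
    (hK : 0 < K) (hM : (n * K ^ 2 + 1) * (M * (2 ^ n * K ^ m)) ≤ K ^ n) {τ : ℝ} (hτ : 0 < τ)
    (hgap : 4 * τ * K ^ 2 ≤ |∫ h, h ∂μ| * A * (m + 1)) :
    ∃ c : DICode A M n, c.HasErrorsLE μ σ
      (n * symbolVariance μ σ A / τ ^ 2) (n * symbolVariance μ σ A / τ ^ 2) := by
  obtain ⟨w, henergy, hdist⟩ := exists_equalEnergy_code hK hM
  let u (i : Fin M) : Fin n → ℝ := gridPoint A (w i)
  have hpower (i : Fin M) : ∑ t, u i t ^ 2 ≤ n * A := by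
    simpa using Finset.sum_le_card_nsmul Finset.univ _ _ fun t _ => sq_gridPoint_le hA (w i) t
  refine ⟨correlationCode u hpower _ τ, correlationCode_hasErrorsLE hμ hσ hpower hτ
    (fun i => sq_gridPoint_le hA (w i)) fun i j hij => ?_⟩
  have hnorm : u i ⬝ᵥ u i = u j ⬝ᵥ u j := by
    simp only [u, gridPoint_dotProduct_self hA, henergy i j]
  have hinner : u j ⬝ᵥ u j - u j ⬝ᵥ u i = (u j - u i) ⬝ᵥ (u j - u i) / 2 := by
    linarith [two_mul_dotProduct_self_sub hnorm]
  have : (0 : ℝ) < K := by exact_mod_cast hK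
  have hm : (m : ℝ) + 1 ≤ hammingDist (w j) (w i) := by exact_mod_cast hdist hij.symm
  rw [hinner]
  calc 2 * τ = 4 * τ * K ^ 2 / (2 * K ^ 2) := by field_simp; norm_num
    _ ≤ |∫ h, h ∂μ| * A * (m + 1) / (2 * K ^ 2) := by gcongr
    _ = |∫ h, h ∂μ| * (A / K ^ 2 * (m + 1) / 2) := by field_simp
    _ ≤ |∫ h, h ∂μ| * (A / K ^ 2 * hammingDist (w j) (w i) / 2) := by gcongr
    _ ≤ |∫ h, h ∂μ| * ((u j - u i) ⬝ᵥ (u j - u i) / 2) := by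
        gcongr
        exact mul_hammingDist_le_gridPoint_sub hA (w j) (w i)

lemma exists_DICode_hasErrorsLE_rpow (hμ : MemLp id 2 μ) (h_mean : ∫ x, x ∂μ ≠ 0) (hσ : σ ≠ 0)
    (hA : 0 < A) {n : ℕ} {R γ ε : ℝ} (hn : 1 ≤ n) (hR : 0 ≤ R) (hγ : 0 ≤ γ) (hγ1 : γ ≤ 1)
    (hε : 0 < ε) (hε1 : ε ≤ 1) (hlarge : 64 ≤ (n : ℝ) ^ (γ * (1 - ε) - R)) :
    ∃ c : DICode A ⌈(n : ℝ) ^ ((n : ℝ) * R)⌉₊ n, c.HasErrorsLE μ σ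
      (symbolVariance μ σ A / (|∫ x, x ∂μ| * A * ε / 16) ^ 2 * (n : ℝ) ^ (4 * γ - 1))
      (symbolVariance μ σ A / (|∫ x, x ∂μ| * A * ε / 16) ^ 2 * (n : ℝ) ^ (4 * γ - 1)) := by
  set b := |∫ x, x ∂μ| * A * ε / 16 with hb
  have : 0 < b := by positivity
  have hn1 : (1 : ℝ) ≤ n := by exact_mod_cast hn
  have hn0 : (0 : ℝ) < n := by linarith
  have hKn : ⌈(n : ℝ) ^ γ⌉₊ ≤ n := Nat.ceil_le.2 (Real.rpow_le_self_of_one_le hn1 hγ1)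
  have hfloor : (⌊ε * n⌋₊ : ℝ) ≤ ε * n := Nat.floor_le (by positivity)
  have hmn : ⌊ε * n⌋₊ ≤ n := by
    exact_mod_cast hfloor.trans (mul_le_of_le_one_left hn0.le hε1)
  have hgap : 4 * (b * (n : ℝ) ^ (1 - 2 * γ)) * (⌈(n : ℝ) ^ γ⌉₊ : ℝ) ^ 2 ≤
      |∫ x, x ∂μ| * A * (⌊ε * n⌋₊ + 1) :=
    calc 4 * (b * (n : ℝ) ^ (1 - 2 * γ)) * (⌈(n : ℝ) ^ γ⌉₊ : ℝ) ^ 2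
        = 4 * b * ((n : ℝ) ^ (1 - 2 * γ) * (⌈(n : ℝ) ^ γ⌉₊ : ℝ) ^ 2) := by ring
      _ ≤ 4 * b * (4 * n) :=
          mul_le_mul_of_nonneg_left (rpow_mul_ceil_rpow_sq_le hn1 hγ) (by positivity)
      _ = |∫ x, x ∂μ| * A * (ε * n) := by rw [hb]; ring
      _ ≤ |∫ x, x ∂μ| * A * (⌊ε * n⌋₊ + 1) := by
          gcongr
          exact (Nat.lt_floor_add_one _).le
  have herror : n * symbolVariance μ σ A / (b * (n : ℝ) ^ (1 - 2 * γ)) ^ 2 =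
      symbolVariance μ σ A / b ^ 2 * (n : ℝ) ^ (4 * γ - 1) := by
    rw [← div_rpow_sq_eq_rpow hn0, mul_pow, div_mul_div_comm, mul_comm (n : ℝ)]
  have hsize : (⌈(n : ℝ) ^ ((n : ℝ) * R)⌉₊ : ℝ) ≤ 2 * (n : ℝ) ^ ((n : ℝ) * R) :=
    Nat.ceil_le_two_mul (by linarith [Real.one_le_rpow hn1 (mul_nonneg hn0.le hR)])
  rw [← herror]
  exact exists_DICode_hasErrorsLE hμ hσ hA.le (Nat.ceil_pos.2 (by positivity))
    (codeSize_mul_le_pow hn hγ (Nat.le_ceil _) hKn hmn hfloor hsize hlarge) (by positivity) hgap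

lemma isAchievable_of_lt_one_div_four (hμ : MemLp id 2 μ) (h_mean : ∫ x, x ∂μ ≠ 0) (hσ : σ ≠ 0)
    (hA : 0 < A) {R : ℝ} (hR : 0 < R) (hR4 : R < 1 / 4) : IsAchievable μ σ A R := by
  refine ⟨hR, fun l₁ l₂ hl₁ hl₂ => eventually_atTop.1 ?_⟩
  obtain ⟨γ, hRγ, hγ4⟩ := exists_between hR4
  let ε := γ - R
  have hexponent : 0 < γ * (1 - ε) - R := by
    have : γ * (1 - ε) - R = (γ - R) * (1 - γ) := by ring
    rw [this]
    exact mul_pos (by linarith) (by linarith)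
  have hsize : ∀ᶠ n : ℕ in atTop, 64 ≤ (n : ℝ) ^ (γ * (1 - ε) - R) :=
    ((tendsto_rpow_atTop hexponent).comp tendsto_natCast_atTop_atTop).eventually_ge_atTop 64
  have herror : Tendsto (fun n : ℕ =>
      symbolVariance μ σ A / (|∫ x, x ∂μ| * A * ε / 16) ^ 2 * (n : ℝ) ^ (4 * γ - 1))
      atTop (𝓝 0) := by
    have hdecay := (tendsto_rpow_neg_atTop (y := 1 - 4 * γ) (by linarith)).comp
      (tendsto_natCast_atTop_atTop (R := ℝ))
    simpa using hdecay.const_mul (symbolVariance μ σ A / (|∫ x, x ∂μ| * A * ε / 16) ^ 2)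
  filter_upwards [hsize, herror.eventually_le_const (lt_min hl₁ hl₂), eventually_ge_atTop 1]
    with n hn_size hn_error hn
  obtain ⟨c, hc⟩ := exists_DICode_hasErrorsLE_rpow hμ h_mean hσ hA hn hR.le
    (by linarith) (by linarith) (sub_pos.2 hRγ) (by linarith) hn_size
  exact ⟨c, hc.mono (hn_error.trans (min_le_left _ _)) (hn_error.trans (min_le_right _ _))⟩

end Rate

lemma ofReal_le_capacityDI_of_forall_lt {μ : Measure ℝ} {σ A C : ℝ}
    (h : ∀ R, 0 < R → R < C → IsAchievable μ σ A R) :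
    ENNReal.ofReal C ≤ capacityDI μ σ A := by
  refine le_of_forall_lt_imp_le_of_dense fun r hr => ?_
  rcases eq_or_ne r 0 with rfl | hr0
  · exact zero_le
  have hachievable : IsAchievable μ σ A r.toReal := h _ (ENNReal.toReal_pos hr0 hr.ne_top)
    ((ENNReal.lt_ofReal_iff_toReal_lt hr.ne_top).1 hr)
  calc r = ENNReal.ofReal r.toReal := (ENNReal.ofReal_toReal hr.ne_top).symm
    _ ≤ capacityDI μ σ A := le_iSup₂ (f := fun R _ => ENNReal.ofReal R) r.toReal hachievable

end FastFading

theorem mainTheorem5_general (μ : Measure ℝ) [IsProbabilityMeasure μ] (σ A : ℝ) (hσ : 0 < σ)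
    (hA : 0 < A) (h_second : MemLp id 2 μ) (h_mean : ∫ x, x ∂μ ≠ 0) :
    (1 / 4 : ℝ≥0∞) ≤ FastFading.capacityDI μ σ A := by
  have hquarter : (1 / 4 : ℝ≥0∞) = ENNReal.ofReal (1 / 4) := by
    rw [ENNReal.ofReal_div_of_pos (by norm_num)]
    simp
  rw [hquarter]
  exact FastFading.ofReal_le_capacityDI_of_forall_lt fun R hR hR4 =>
    FastFading.isAchievable_of_lt_one_div_four h_second h_mean hσ.ne' hA hR hR4

theorem mainTheorem5 (μ : MeasureTheory.Measure ℝ) [MeasureTheory.IsProbabilityMeasure μ]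
    (σ A : ℝ) (hσ : 0 < σ) (hA : 0 < A)
    (h_fourth : MeasureTheory.Integrable (fun x : ℝ => x ^ 4) μ)
    (h_mean : ∫ x, x ∂μ ≠ 0) :
    (1 / 4 : ENNReal) ≤ FastFading.capacityDI μ σ A :=
  mainTheorem5_general μ σ A hσ hA
    ((memLp_of_integrable_pow aestronglyMeasurable_id four_ne_zero h_fourth).mono_exponent
      (by norm_num)) h_mean
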